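/- Let $G$ be a group. A subset $A\subset G$ is \emph{self-linked} if $A\cap xA\neq\emptyset$ for every $x\in G$, and $sl(G)$ denotes the smallest cardinality of a self-linked subset of $G$. An \emph{invariant linked system} on $G$ is a family $\mathcal A$ of non-empty subsets of $G$ which is closed under taking supersets in $G$, is linked (that is, $A\cap B\neq\emptyset$ for all $A,B\in\mathcal A$), and is invariant (that is, $\{xA:A\in\mathcal A\}=\mathcal A$ for every $x\in G$). A \emph{maximal invariant linked system} is an invariant linked system that is maximal with respect to inclusion among all invariant linked systems on $G$; let $\overset{\leftrightarrow}{\lambda}(G)$ be the set of all of them. \textbf{Theorem.} Every group $G$ of order $|G|\le 8$ is isomorphic to one of the groups in the following table, and $sl(G)$ and the cardinality of $\overset{\leftrightarrow}{\lambda}(G)$ are as given there: $$ \begin{array}{|c|c|c|c|cc|c|cc|c|ccccc|} \hline G& C_1& C_2& C_3 &C_4 &C_2\oplus C_2& C_5 &D_6& C_6& C_7 & C_2^3 &D_8 &C_4\oplus C_2 & C_8 & Q_8\\ \hline sl(G)&1&2&2&3&3&3&4&3&3&5&4&4&4&4\\ |\overset{\leftrightarrow}{\lambda}(G)|&1&1&1&1&1&1&1&2&3&1&2&4&8&8\\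 \hline \end{array} $$ Here $C_n$ is the cyclic group of order $n$, $D_{2n}$ is the dihedral group of order $2n$, and $Q_8$ is the quaternion group of order $8$. -/

import Mathlib

open scoped Pointwise

universe u

/-- A subset `A` of a group is self-linked if it meets each of its left shifts `xA`. -/
def IsSelfLinked {G : Type u} [Group G] (A : Set G) : Prop :=
  ∀ x : G, (A ∩ x • A).Nonempty

/-- `sl(G)`: the smallest cardinality of a self-linked subset of `G`
(the whole group is always self-linked, so the infimum is attained). -/
noncomputable def selfLinkedNumber (G : Type u) [Group G] : Cardinal.{u} :=
  sInf {κ | ∃ A : Set G, IsSelfLinked A ∧ Cardinal.mk A = κ}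

/-- An inclusion hyperspace on `X`: a family of nonempty subsets of `X` closed under supersets. -/
def IsInclusionHyperspace {X : Type u} (F : Set (Set X)) : Prop :=
  (∀ A ∈ F, A.Nonempty) ∧ ∀ A ∈ F, ∀ B : Set X, A ⊆ B → B ∈ F

/-- A family of sets is linked if any two of its members intersect. -/
def IsLinkedFamily {X : Type u} (F : Set (Set X)) : Prop :=
  ∀ A ∈ F, ∀ B ∈ F, (A ∩ B).Nonempty

/-- A family `F` of subsets of a group is invariant if `xF = {xA : A ∈ F}` equals `F` for all `x`. -/
def IsInvariantFamily {G : Type u} [Group G] (F : Set (Set G)) : Prop :=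
  ∀ x : G, (fun A : Set G => x • A) '' F = F

/-- Invariant linked systems on `G`: the inclusion hyperspaces that are linked and invariant. -/
def IsInvariantLinkedSystem {G : Type u} [Group G] (F : Set (Set G)) : Prop :=
  IsInclusionHyperspace F ∧ IsLinkedFamily F ∧ IsInvariantFamily F

/-- The set of maximal invariant linked systems on `G`: those invariant linked systems that are
maximal, with respect to inclusion, among all invariant linked systems
(they need not be maximal linked). -/
def maximalInvariantLinkedSystems (G : Type u) [Group G] : Set (Set (Set G)) :=
  {F | Maximal IsInvariantLinkedSystem F}

/-- `G` and `H` are isomorphic groups. -/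
def GroupIso (G : Type u) [Group G] (H : Type) [Group H] : Prop :=
  Nonempty (G ≃* H)

/-- The column of the table belonging to `G`: `sl(G) = s`, and there are exactly `m` maximal
invariant linked systems on `G`. -/
def HasTableColumn (G : Type u) [Group G] (s m : ℕ) : Prop :=
  selfLinkedNumber G = (s : Cardinal.{u}) ∧
    Cardinal.mk (maximalInvariantLinkedSystems G) = (m : Cardinal.{u})

/-! Call `A` and `B` translation-linked if `A` meets every `xB`. Linkedness and invariance together
make an invariant linked system a clique for this symmetric relation, whose looped vertices are the
self-linked sets. Conversely, the relation is monotone and shift-invariant, so a maximal clique is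
already closed under supersets and shifts. On a finite group the systems to be counted are therefore
exactly the maximal cliques (`maximalInvariantLinkedSystems_eq`).

Self-linked sets linked to all others lie in every maximal clique, and shifts of one set have the
same neighbours. Hence only a small graph on representatives of the remaining orbits matters
(`natCard_maximal_isRelClique`). With subsets coded as bit masks, `sl(G)` and this graph become
kernel computations.

The list of groups is complete because, outside the cyclic and exponent-two cases, a cyclic subgroup
`⟨a⟩` of index two and an outside element `b` determine the group through `b²` and the action of `b`
on `a`. -/

/-! ### Maximal cliques of a relation -/

/-- A set of vertices is a clique of `R` if any two of its members, equal or not, are related. -/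
def IsRelClique {V : Type*} (R : V → V → Prop) (F : Set V) : Prop :=
  ∀ u ∈ F, ∀ v ∈ F, R u v

/-- A clique that is not maximal can be enlarged by a single vertex, which must itself carry a loop.
-/
theorem maximal_isRelClique_iff {V : Type*} {R : V → V → Prop} (hR : ∀ u v, R u v → R v u)
    {F : Set V} : Maximal (IsRelClique R) F ↔
      IsRelClique R F ∧ ∀ v, R v v → (∀ u ∈ F, R v u) → v ∈ F := by
  refine ⟨fun h => ⟨h.1, fun v hv hF => ?_⟩, fun h => ⟨h.1, fun F' hF' hle v hv => ?_⟩⟩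
  · have hc : IsRelClique R (insert v F) := by
      rintro a (rfl | ha) b (rfl | hb)
      · exact hv
      · exact hF b hb
      · exact hR _ _ (hF a ha)
      · exact h.1 a ha b hb
    exact h.2 hc (Set.subset_insert v F) (Set.mem_insert v F)
  · exact h.2 v (hF' v hv v hv) fun u hu => hF' v hv u (hle hu)

/-- The maximal cliques of a Boolean relation on a finite type. -/
def maxCliques {ι : Type*} [Fintype ι] [DecidableEq ι] (r : ι → ι → Bool) : Finset (Finset ι) :=
  Finset.univ.filter fun S =>
    (∀ i ∈ S, ∀ j ∈ S, r i j = true) ∧ ∀ i, i ∉ S → ∃ j ∈ S, r i j = false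

/-- If every looped vertex is adjacent to all looped vertices or is a twin of some `ρ i`, then the
maximal cliques are counted by those of the relation induced on the indices of `ρ`. -/
theorem natCard_maximal_isRelClique {V ι : Type*} [Fintype ι] [DecidableEq ι]
    {R : V → V → Prop} (hR : ∀ u v, R u v → R v u) (ρ : ι → V) (hρ : ∀ i, R (ρ i) (ρ i))
    (h : ∀ u, R u u → (∀ v, R v v → R u v) ∨ ∃ i, ∀ w, R u w ↔ R (ρ i) w)
    (r : ι → ι → Bool) (hr : ∀ i j, r i j = true ↔ R (ρ i) (ρ j)) :
    Nat.card {F : Set V | Maximal (IsRelClique R) F} = (maxCliques r).card := by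
  classical
  have hr' : ∀ i j, r i j = false ↔ ¬ R (ρ i) (ρ j) := fun i j => by rw [← hr]; simp
  have hmax : ∀ F : Set V, F ∈ {F : Set V | Maximal (IsRelClique R) F} ↔
      IsRelClique R F ∧ ∀ v, R v v → (∀ u ∈ F, R v u) → v ∈ F :=
    fun F => maximal_isRelClique_iff hR
  have hmem : ∀ S : Finset ι, S ∈ maxCliques r ↔ (∀ i ∈ S, ∀ j ∈ S, R (ρ i) (ρ j)) ∧
      ∀ i, i ∉ S → ∃ j ∈ S, ¬ R (ρ i) (ρ j) := by
    intro S
    simp only [maxCliques, Finset.mem_filter, Finset.mem_univ, true_and, hr, hr']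
  -- Twins of members belong to a maximal clique too, so `F` is controlled by the `ρ i` it contains.
  have htwin : ∀ F : Set V, F ∈ {F : Set V | Maximal (IsRelClique R) F} → ∀ u ∈ F,
      (∀ v, R v v → R u v) ∨ ∃ i, ρ i ∈ F ∧ ∀ w, R u w ↔ R (ρ i) w := by
    intro F hF u hu
    rw [hmax] at hF
    rcases h u (hF.1 u hu u hu) with h1 | ⟨i, hi⟩
    · exact Or.inl h1
    · exact Or.inr ⟨i, hF.2 _ (hρ i) fun w hw => (hi w).1 (hF.1 u hu w hw), hi⟩
  let f : Set V → Finset ι := fun F => Finset.univ.filter fun i => ρ i ∈ F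
  have hbij : Set.BijOn f {F : Set V | Maximal (IsRelClique R) F} (maxCliques r : Set _) := by
    refine ⟨fun F hF => ?_, fun F hF F' hF' hff => ?_, fun S hS => ?_⟩
    · have hF' := (hmax F).1 hF
      rw [Finset.mem_coe, hmem]
      simp only [f, Finset.mem_filter, Finset.mem_univ, true_and]
      refine ⟨fun i hi j hj => hF'.1 _ hi _ hj, fun i hi => ?_⟩
      by_contra! hcon
      refine hi (hF'.2 _ (hρ i) fun u hu => ?_)
      rcases htwin F hF u hu with h1 | ⟨j, hj, hw⟩
      · exact hR _ _ (h1 _ (hρ i))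
      · exact hR _ _ ((hw _).2 (hR _ _ (hcon j hj)))
    -- A maximal clique is recovered from its trace on `ρ`, as universal vertices impose no
    -- condition.
    · have key : ∀ F, F ∈ {F : Set V | Maximal (IsRelClique R) F} → ∀ v, v ∈ F ↔
          R v v ∧ ∀ i ∈ f F, R v (ρ i) := by
        intro F hF v
        have hF' := (hmax F).1 hF
        simp only [f, Finset.mem_filter, Finset.mem_univ, true_and]
        refine ⟨fun hv => ⟨hF'.1 v hv v hv, fun i hi => hF'.1 v hv _ hi⟩,
          fun hv => hF'.2 v hv.1 fun u hu => ?_⟩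
        rcases htwin F hF u hu with h1 | ⟨j, hj, hw⟩
        · exact hR _ _ (h1 _ hv.1)
        · exact hR _ _ ((hw _).2 (hR _ _ (hv.2 j hj)))
      ext v
      rw [key F hF, key F' hF', hff]
    · rw [Finset.mem_coe, hmem] at hS
      refine ⟨{v | R v v ∧ ∀ i ∈ S, R v (ρ i)}, ?_, ?_⟩
      · rw [hmax]
        refine ⟨fun u hu v hv => ?_, fun v hv hF => ⟨hv, fun i hi =>
          hF _ ⟨hρ i, fun j hj => hS.1 i hi j hj⟩⟩⟩
        rcases h u hu.1 with h1 | ⟨j, hj⟩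
        · exact h1 v hv.1
        · by_cases hjS : j ∈ S
          · exact (hj v).2 (hR _ _ (hv.2 j hjS))
          · obtain ⟨i, hi, hn⟩ := hS.2 j hjS
            exact absurd ((hj _).1 (hu.2 i hi)) hn
      · ext i
        simp only [f, Finset.mem_filter, Finset.mem_univ, true_and, Set.mem_ofPred_eq]
        refine ⟨fun hi => ?_, fun hi => ⟨hρ i, fun j hj => hS.1 i hi j hj⟩⟩
        by_contra hiS
        obtain ⟨j, hj, hn⟩ := hS.2 i hiS
        exact hn (hi.2 j hj)
  rw [Nat.card_congr hbij.equiv]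
  simp

/-! ### Maximal invariant linked systems as maximal cliques -/

/-- Two subsets of a group are translation-linked if the first meets every left shift of the
second. -/
def IsTranslateLinked {G : Type u} [Group G] (A B : Set G) : Prop :=
  ∀ x : G, (A ∩ x • B).Nonempty

section TranslateLinked

variable {G : Type u} [Group G] {A B C : Set G}

theorem IsTranslateLinked.symm (h : IsTranslateLinked A B) : IsTranslateLinked B A := by
  intro x
  obtain ⟨g, hg, hg'⟩ := h x⁻¹
  exact ⟨x * g, by simpa [Set.mem_smul_set_iff_inv_smul_mem] using hg', Set.smul_mem_smul_set hg⟩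

theorem isTranslateLinked_smul_right (g : G) :
    IsTranslateLinked A (g • B) ↔ IsTranslateLinked A B := by
  refine ⟨fun h x => ?_, fun h x => ?_⟩
  · simpa [smul_smul] using h (x * g⁻¹)
  · simpa [smul_smul] using h (x * g)

theorem isTranslateLinked_smul_left (g : G) :
    IsTranslateLinked (g • A) B ↔ IsTranslateLinked A B :=
  ⟨fun h => ((isTranslateLinked_smul_right g).1 h.symm).symm,
    fun h => ((isTranslateLinked_smul_right g).2 h.symm).symm⟩

theorem IsTranslateLinked.mono_right (h : IsTranslateLinked A B) (hBC : B ⊆ C) :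
    IsTranslateLinked A C := fun x =>
  (h x).mono (Set.inter_subset_inter_right _ (Set.smul_set_mono hBC))

theorem IsInvariantLinkedSystem.isRelClique {F : Set (Set G)} (hF : IsInvariantLinkedSystem F) :
    IsRelClique IsTranslateLinked F := by
  intro A hA B hB x
  refine hF.2.1 A hA _ ?_
  rw [← hF.2.2 x]
  exact ⟨B, hB, rfl⟩

theorem isInvariantLinkedSystem_of_maximal_isRelClique {F : Set (Set G)}
    (hF : Maximal (IsRelClique IsTranslateLinked) F) : IsInvariantLinkedSystem F := by
  rw [maximal_isRelClique_iff fun A B h => h.symm] at hF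
  obtain ⟨hc, hm⟩ := hF
  have hsmul : ∀ x : G, ∀ A ∈ F, x • A ∈ F := fun x A hA =>
    hm _ ((isTranslateLinked_smul_left x).2 ((isTranslateLinked_smul_right x).2 (hc A hA A hA)))
      fun B hB => (isTranslateLinked_smul_left x).2 (hc A hA B hB)
  refine ⟨⟨fun A hA => (hc A hA A hA 1).mono Set.inter_subset_left, fun A hA B hAB => ?_⟩,
    fun A hA B hB => by simpa using hc A hA B hB 1, fun x => ?_⟩
  · have h1 : ∀ C ∈ F, IsTranslateLinked C B := fun C hC => (hc C hC A hA).mono_right hAB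
    exact hm B ((h1 A hA).symm.mono_right hAB) fun C hC => (h1 C hC).symm
  · refine Set.Subset.antisymm (Set.image_subset_iff.2 fun A hA => hsmul x A hA) fun A hA =>
      ⟨x⁻¹ • A, hsmul _ A hA, by simp⟩

/-- Finiteness is what places every clique below a maximal one, which is then an invariant linked
system. -/
theorem maximalInvariantLinkedSystems_eq [Finite G] :
    maximalInvariantLinkedSystems G = {F | Maximal (IsRelClique (IsTranslateLinked (G := G))) F} := by
  ext F
  refine ⟨fun hF => ⟨hF.1.isRelClique, fun F' hF' hle => ?_⟩, fun hF =>
    ⟨isInvariantLinkedSystem_of_maximal_isRelClique hF, fun F' hF' hle =>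
      hF.2 hF'.isRelClique hle⟩⟩
  obtain ⟨F'', hle', hmax⟩ :=
    (Set.toFinite {F : Set (Set G) | IsRelClique IsTranslateLinked F}).exists_le_maximal hF'
  exact hle'.trans (hF.2 (isInvariantLinkedSystem_of_maximal_isRelClique hmax) (hle.trans hle'))

end TranslateLinked

/-! ### Subsets of a finite group as bit masks -/

/-- The number below `2 ^ n` whose binary digits are given by `f`. -/
def maskOf (f : ℕ → Bool) : ℕ → ℕ
  | 0 => 0
  | k + 1 => Nat.lor (maskOf f k) (Nat.shiftLeft (f k).toNat k)

theorem testBit_maskOf (f : ℕ → Bool) (n j : ℕ) :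
    (maskOf f n).testBit j = (decide (j < n) && f j) := by
  induction n with
  | zero => simp [maskOf]
  | succ k ih =>
    -- `maskOf` uses the bare `Nat` functions for the sake of kernel evaluation; the lemmas are
    -- stated for the notations.
    change (maskOf f k ||| (f k).toNat <<< k).testBit j = _
    rw [Nat.testBit_or, ih, Nat.testBit_shiftLeft]
    rcases lt_trichotomy j k with h | rfl | h
    · simp [h, h.not_ge, h.trans (Nat.lt_succ_self k)]
    · cases f j <;> simp
    · have h1 : ¬ j < k := by omega
      have h2 : ¬ j < k + 1 := by omega
      have h3 : (f k).toNat.testBit (j - k) = false := by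
        obtain ⟨d, hd⟩ : ∃ d, j - k = d + 1 := ⟨j - k - 1, by omega⟩
        rw [hd]
        cases f k <;> simp [Nat.testBit_succ]
      simp [h1, h2, h3]

theorem maskOf_lt (f : ℕ → Bool) (n : ℕ) : maskOf f n < 2 ^ n := by
  refine Nat.lt_pow_two_of_testBit _ fun i hi => ?_
  simp [testBit_maskOf, hi.not_gt]

/-- `t` describes the division `x⁻¹ * y` of `G` in terms of a numbering `e` of `G` by the numbers
below `n`. -/
structure IsNumbering (G : Type u) [Group G] (n : ℕ) (t : ℕ → ℕ → ℕ) (e : G → ℕ) : Prop where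
  injective : ∀ x y, e x = e y → x = y
  lt : ∀ x, e x < n
  surjective : ∀ i < n, ∃ x, e x = i
  inv_mul : ∀ x y, e (x⁻¹ * y) = t (e x) (e y)

/-- The mask of the left shift by the element number `i` of the set with mask `m`. -/
def maskTranslate (n : ℕ) (t : ℕ → ℕ → ℕ) (i m : ℕ) : ℕ :=
  maskOf (fun j => m.testBit (t i j)) n

/-- Translation-linkedness of sets given by masks. -/
def maskLinked (n : ℕ) (t : ℕ → ℕ → ℕ) (a b : ℕ) : Bool :=
  (List.range n).all fun i => Nat.blt 0 (Nat.land a (maskTranslate n t i b))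

/-- The masks of the self-linked sets. -/
def selfLinkedMasks (n : ℕ) (t : ℕ → ℕ → ℕ) : List ℕ :=
  (List.range (2 ^ n)).filter fun a => maskLinked n t a a

/-- The number of elements of a mask. -/
def maskCard (n m : ℕ) : ℕ := (List.range n).countP m.testBit

/-- A mask is a left shift of a member of the list `ρ`. -/
def isTranslateOfMem (n : ℕ) (t : ℕ → ℕ → ℕ) (ρ : List ℕ) (a : ℕ) : Bool :=
  ρ.any fun b => (List.range n).any fun i => Nat.beq a (maskTranslate n t i b)

/-- Every self-linked mask has at least `s` elements, with equality for some, and is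
translation-linked to all self-linked masks unless it is a left shift of a member of `ρ`. -/
def checkMasks (n : ℕ) (t : ℕ → ℕ → ℕ) (s : ℕ) (ρ : List ℕ) : Bool :=
  (selfLinkedMasks n t).any (fun a => Nat.beq (maskCard n a) s) &&
  ((selfLinkedMasks n t).all (fun a => Nat.ble s (maskCard n a)) &&
  (ρ.all (fun a => maskLinked n t a a) &&
  ((selfLinkedMasks n t).filter fun a => !isTranslateOfMem n t ρ a).all
    fun a => (selfLinkedMasks n t).all fun b => maskLinked n t a b))

section Masks

variable {G : Type u} [Group G] {n : ℕ} {t : ℕ → ℕ → ℕ} {e : G → ℕ}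

/-- The set with mask `m`. -/
def maskSet (e : G → ℕ) (m : ℕ) : Set G := {g | m.testBit (e g) = true}

theorem IsNumbering.exists_maskSet_eq (h : IsNumbering G n t e) (A : Set G) :
    ∃ m < 2 ^ n, maskSet e m = A := by
  classical
  refine ⟨maskOf (fun j => decide (∃ g ∈ A, e g = j)) n, maskOf_lt _ _, ?_⟩
  ext g
  simp only [maskSet, Set.mem_ofPred_eq, testBit_maskOf, Bool.and_eq_true, decide_eq_true_eq]
  refine ⟨?_, fun hg => ⟨h.lt g, g, hg, rfl⟩⟩
  rintro ⟨-, g', hg', he⟩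
  rwa [← h.injective _ _ he]

/-- Membership of `g` in `xA` means `x⁻¹g ∈ A`; this is why `t` records division rather than
multiplication. -/
theorem IsNumbering.maskSet_maskTranslate (h : IsNumbering G n t e) (x : G) (m : ℕ) :
    maskSet e (maskTranslate n t (e x) m) = x • maskSet e m := by
  ext g
  rw [Set.mem_smul_set_iff_inv_smul_mem, smul_eq_mul]
  simp [maskSet, maskTranslate, testBit_maskOf, h.lt g, h.inv_mul]

theorem IsNumbering.maskLinked_iff (h : IsNumbering G n t e) (a b : ℕ) :
    maskLinked n t a b = true ↔ IsTranslateLinked (maskSet e a) (maskSet e b) := by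
  have key : ∀ x : G, Nat.blt 0 (Nat.land a (maskTranslate n t (e x) b)) = true ↔
      (maskSet e a ∩ x • maskSet e b).Nonempty := by
    intro x
    rw [Nat.blt_eq, ← h.maskSet_maskTranslate]
    change 0 < a &&& _ ↔ _
    refine ⟨fun hpos => ?_, ?_⟩
    · obtain ⟨j, hj⟩ := Nat.exists_testBit_of_ne_zero hpos.ne'
      rw [Nat.testBit_and, Bool.and_eq_true] at hj
      have hjn : j < n := by
        have := hj.2
        rw [maskTranslate, testBit_maskOf, Bool.and_eq_true, decide_eq_true_eq] at this
        exact this.1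
      obtain ⟨g, rfl⟩ := h.surjective j hjn
      exact ⟨g, hj.1, hj.2⟩
    · rintro ⟨g, hg, hg'⟩
      refine Nat.pos_of_ne_zero fun h0 => ?_
      have : (a &&& maskTranslate n t (e x) b).testBit (e g) = true := by
        rw [Nat.testBit_and, Bool.and_eq_true]
        exact ⟨hg, hg'⟩
      simp [h0] at this
  simp only [maskLinked, List.all_eq_true, List.mem_range]
  refine ⟨fun hx x => (key x).1 (hx _ (h.lt x)), fun hx i hi => ?_⟩
  obtain ⟨x, rfl⟩ := h.surjective i hi
  exact (key x).2 (hx x)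

theorem IsNumbering.natCard_maskSet (h : IsNumbering G n t e) (m : ℕ) :
    Nat.card (maskSet e m) = maskCard n m := by
  have hb : Set.BijOn e (maskSet e m) ((Finset.range n).filter fun j => m.testBit j = true) := by
    refine ⟨fun g hg => Finset.mem_filter.2 ⟨Finset.mem_range.2 (h.lt g), hg⟩, fun x _ y _ hxy => h.injective x y hxy,
      fun j hj => ?_⟩
    rw [Finset.mem_coe, Finset.mem_filter, Finset.mem_range] at hj
    obtain ⟨g, rfl⟩ := h.surjective j hj.1
    exact ⟨g, hj.2, rfl⟩
  rw [Nat.card_congr hb.equiv, Nat.card_coe_set_eq, Set.ncard_coe_finset, maskCard,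
    List.countP_eq_length_filter]
  simp [Finset.card, Finset.filter, Finset.range, Multiset.range]

theorem IsNumbering.mem_selfLinkedMasks (h : IsNumbering G n t e) {m : ℕ} (hm : m < 2 ^ n) :
    m ∈ selfLinkedMasks n t ↔ IsTranslateLinked (maskSet e m) (maskSet e m) := by
  simp [selfLinkedMasks, hm, h.maskLinked_iff]

theorem IsNumbering.hasTableColumn (h : IsNumbering G n t e) {s m : ℕ} {ρ : List ℕ}
    (hc : checkMasks n t s ρ = true)
    (hm : (maxCliques fun i j : Fin ρ.length => maskLinked n t (ρ.get i) (ρ.get j)).card = m) :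
    HasTableColumn G s m := by
  have : Finite G := Finite.of_injective (fun g => (⟨e g, h.lt g⟩ : Fin n)) fun x y hxy =>
    h.injective x y (Fin.mk.inj_iff.1 hxy)
  simp only [checkMasks, Bool.and_eq_true] at hc
  obtain ⟨hex, hall, hρ, hun⟩ := hc
  rw [List.all_eq_true] at hall hρ hun
  rw [List.any_eq_true] at hex
  have hcard : ∀ A : Set G, Cardinal.mk A = (Nat.card A : Cardinal) := fun A =>
    Nat.cast_card.symm
  refine ⟨le_antisymm ?_ ?_, ?_⟩
  · obtain ⟨a, ha, has⟩ := hex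
    have hlt : a < 2 ^ n := by
      simp only [selfLinkedMasks, List.mem_filter, List.mem_range] at ha
      exact ha.1
    refine csInf_le' ⟨maskSet e a, (h.mem_selfLinkedMasks hlt).1 ha, ?_⟩
    rw [hcard, h.natCard_maskSet, Nat.eq_of_beq_eq_true has]
  · refine le_csInf ⟨_, Set.univ, fun x => by simp, rfl⟩ ?_
    rintro κ ⟨A, hA, rfl⟩
    obtain ⟨a, hlt, rfl⟩ := h.exists_maskSet_eq A
    rw [hcard, h.natCard_maskSet]
    exact_mod_cast Nat.le_of_ble_eq_true (hall a ((h.mem_selfLinkedMasks hlt).2 hA))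
  · rw [← Nat.cast_card, maximalInvariantLinkedSystems_eq, ← hm]
    congr 1
    refine natCard_maximal_isRelClique (fun A B hAB => hAB.symm)
      (fun i : Fin ρ.length => maskSet e (ρ.get i))
      (fun i => (h.maskLinked_iff _ _).1 (hρ _ (List.get_mem ρ i))) ?_ _
      fun i j => h.maskLinked_iff _ _
    intro A hA
    obtain ⟨a, hlt, rfl⟩ := h.exists_maskSet_eq A
    have ha := (h.mem_selfLinkedMasks hlt).2 hA
    by_cases htr : isTranslateOfMem n t ρ a = true
    · right
      simp only [isTranslateOfMem, List.any_eq_true, List.mem_range] at htr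
      obtain ⟨b, hb, i, hi, hab⟩ := htr
      obtain ⟨x, rfl⟩ := h.surjective i hi
      obtain ⟨k, rfl⟩ := List.get_of_mem hb
      refine ⟨k, fun w => ?_⟩
      rw [Nat.eq_of_beq_eq_true hab, h.maskSet_maskTranslate, isTranslateLinked_smul_left]
    · left
      intro B hB
      obtain ⟨b, hbt, rfl⟩ := h.exists_maskSet_eq B
      have hu := hun a (List.mem_filter.2 ⟨ha, by simpa using htr⟩)
      rw [List.all_eq_true] at hu
      exact (h.maskLinked_iff _ _).1 (hu b ((h.mem_selfLinkedMasks hbt).2 hB))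

theorem IsNumbering.comp_mulEquiv {H : Type*} [Group H] {e : H → ℕ} (h : IsNumbering H n t e)
    (φ : G ≃* H) : IsNumbering G n t fun g => e (φ g) where
  injective x y hxy := φ.injective (h.injective _ _ hxy)
  lt x := h.lt _
  surjective i hi := by
    obtain ⟨y, hy⟩ := h.surjective i hi
    exact ⟨φ.symm y, by simpa using hy⟩
  inv_mul x y := by simpa using h.inv_mul (φ x) (φ y)

end Masks

/-! ### The columns of the table -/

theorem GroupIso.hasTableColumn {G : Type u} [Group G] {H : Type} [Group H] (φ : GroupIso G H)
    {n s m : ℕ} {t : ℕ → ℕ → ℕ} {e : H → ℕ} (h : IsNumbering H n t e) (ρ : List ℕ)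
    (hc : checkMasks n t s ρ = true)
    (hm : (maxCliques fun i j : Fin ρ.length => maskLinked n t (ρ.get i) (ρ.get j)).card = m) :
    HasTableColumn G s m :=
  φ.elim fun φ => (h.comp_mulEquiv φ).hasTableColumn hc hm

/-- Division in the cyclic group of order `n`. -/
def cyclicDiv (n i j : ℕ) : ℕ := (j + n - i) % n

/-- Division in the dihedral group of order `2 * n`. -/
def dihedralDiv (n i j : ℕ) : ℕ :=
  if i < n then
    if j < n then (j + n - i) % n else n + (j + i) % n
  else if j < n then n + (i + j) % n else (j + n - i) % n

/-- Division in the quaternion group of order `8`. -/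
def quaternionDiv (i j : ℕ) : ℕ :=
  if i < 4 then
    if j < 4 then (j + 4 - i) % 4 else 4 + (j + i) % 4
  else if j < 4 then 4 + (2 + i + j) % 4 else (j + 4 - i) % 4

theorem isNumbering_zmod_one : IsNumbering (Multiplicative (ZMod 1)) 1 (cyclicDiv 1)
    fun x => x.toAdd.val := by constructor <;> decide +kernel

theorem isNumbering_zmod_two : IsNumbering (Multiplicative (ZMod 2)) 2 (cyclicDiv 2)
    fun x => x.toAdd.val := by constructor <;> decide +kernel

theorem isNumbering_zmod_three : IsNumbering (Multiplicative (ZMod 3)) 3 (cyclicDiv 3)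
    fun x => x.toAdd.val := by constructor <;> decide +kernel

theorem isNumbering_zmod_four : IsNumbering (Multiplicative (ZMod 4)) 4 (cyclicDiv 4)
    fun x => x.toAdd.val := by constructor <;> decide +kernel

/-- In binary coordinates the sum is exclusive or, and every element is its own inverse. -/
theorem isNumbering_zmod_two_prod_zmod_two :
    IsNumbering (Multiplicative (ZMod 2 × ZMod 2)) 4 Nat.xor
      fun x => 2 * x.toAdd.1.val + x.toAdd.2.val := by constructor <;> decide +kernel

theorem isNumbering_zmod_five : IsNumbering (Multiplicative (ZMod 5)) 5 (cyclicDiv 5)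
    fun x => x.toAdd.val := by constructor <;> decide +kernel

theorem isNumbering_dihedralGroup_three : IsNumbering (DihedralGroup 3) 6 (dihedralDiv 3)
    fun | .r i => i.val | .sr i => 3 + i.val := by constructor <;> decide +kernel

theorem isNumbering_zmod_six : IsNumbering (Multiplicative (ZMod 6)) 6 (cyclicDiv 6)
    fun x => x.toAdd.val := by constructor <;> decide +kernel

theorem isNumbering_zmod_seven : IsNumbering (Multiplicative (ZMod 7)) 7 (cyclicDiv 7)
    fun x => x.toAdd.val := by constructor <;> decide +kernel

theorem isNumbering_zmod_two_prod_zmod_two_prod_zmod_two :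
    IsNumbering (Multiplicative (ZMod 2 × ZMod 2 × ZMod 2)) 8 Nat.xor
      fun x => 4 * x.toAdd.1.val + 2 * x.toAdd.2.1.val + x.toAdd.2.2.val := by
  constructor <;> decide +kernel

theorem isNumbering_dihedralGroup_four : IsNumbering (DihedralGroup 4) 8 (dihedralDiv 4)
    fun | .r i => i.val | .sr i => 4 + i.val := by constructor <;> decide +kernel

theorem isNumbering_zmod_four_prod_zmod_two :
    IsNumbering (Multiplicative (ZMod 4 × ZMod 2)) 8
      (fun i j => 2 * cyclicDiv 4 (i / 2) (j / 2) + cyclicDiv 2 (i % 2) (j % 2))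
      fun x => 2 * x.toAdd.1.val + x.toAdd.2.val := by constructor <;> decide +kernel

theorem isNumbering_zmod_eight : IsNumbering (Multiplicative (ZMod 8)) 8 (cyclicDiv 8)
    fun x => x.toAdd.val := by constructor <;> decide +kernel

/-- The summand 2 in `quaternionDiv` comes from `(xa i)⁻¹ = xa (i + 2)`; the offset 4 vanishes
modulo 4. -/
theorem isNumbering_quaternionGroup_two : IsNumbering (QuaternionGroup 2) 8 quaternionDiv
    fun | .a i => i.val | .xa i => 4 + i.val := by constructor <;> decide +kernel

section Columns

variable {G : Type u} [Group G]

/-- The list is empty whenever `2 * sl(G) > |G|`: any two self-linked sets then meet by size, and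
the empty graph has one maximal clique. -/
theorem hasTableColumn_zmod_one (φ : GroupIso G (Multiplicative (ZMod 1))) :
    HasTableColumn G 1 1 :=
  φ.hasTableColumn isNumbering_zmod_one [] (by decide +kernel) (by decide +kernel)

theorem hasTableColumn_zmod_two (φ : GroupIso G (Multiplicative (ZMod 2))) :
    HasTableColumn G 2 1 :=
  φ.hasTableColumn isNumbering_zmod_two [] (by decide +kernel) (by decide +kernel)

theorem hasTableColumn_zmod_three (φ : GroupIso G (Multiplicative (ZMod 3))) :
    HasTableColumn G 2 1 :=
  φ.hasTableColumn isNumbering_zmod_three [] (by decide +kernel) (by decide +kernel)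

theorem hasTableColumn_zmod_four (φ : GroupIso G (Multiplicative (ZMod 4))) :
    HasTableColumn G 3 1 :=
  φ.hasTableColumn isNumbering_zmod_four [] (by decide +kernel) (by decide +kernel)

theorem hasTableColumn_zmod_two_prod_zmod_two
    (φ : GroupIso G (Multiplicative (ZMod 2 × ZMod 2))) : HasTableColumn G 3 1 :=
  φ.hasTableColumn isNumbering_zmod_two_prod_zmod_two [] (by decide +kernel) (by decide +kernel)

theorem hasTableColumn_zmod_five (φ : GroupIso G (Multiplicative (ZMod 5))) :
    HasTableColumn G 3 1 :=
  φ.hasTableColumn isNumbering_zmod_five [] (by decide +kernel) (by decide +kernel)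

theorem hasTableColumn_dihedralGroup_three (φ : GroupIso G (DihedralGroup 3)) :
    HasTableColumn G 4 1 :=
  φ.hasTableColumn isNumbering_dihedralGroup_three [] (by decide +kernel) (by decide +kernel)

/-- The masks are `{0,1,3}` and `{0,2,3}`. The complement of the first is a shift of the second, so
they exclude each other. -/
theorem hasTableColumn_zmod_six (φ : GroupIso G (Multiplicative (ZMod 6))) :
    HasTableColumn G 3 2 :=
  φ.hasTableColumn isNumbering_zmod_six [11, 13] (by decide +kernel) (by decide +kernel)

/-- The linked pairs of distinct representatives form the path 11 – 23 – 29 – 13, whose three edges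
are the maximal cliques. -/
theorem hasTableColumn_zmod_seven (φ : GroupIso G (Multiplicative (ZMod 7))) :
    HasTableColumn G 3 3 :=
  φ.hasTableColumn isNumbering_zmod_seven [11, 13, 23, 29] (by decide +kernel)
    (by decide +kernel)

theorem hasTableColumn_zmod_two_prod_zmod_two_prod_zmod_two
    (φ : GroupIso G (Multiplicative (ZMod 2 × ZMod 2 × ZMod 2))) : HasTableColumn G 5 1 :=
  φ.hasTableColumn isNumbering_zmod_two_prod_zmod_two_prod_zmod_two [] (by decide +kernel)
    (by decide +kernel)

/-- In order eight with `sl(G) = 4`, self-linked sets fail to be linked only if both have four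
elements and one is a shift of the other's complement. The listed orbits thus split into
complementary pairs, and a maximal clique picks one from each: 2, 4 or 8 choices for 1, 2 or 3
pairs. -/
theorem hasTableColumn_dihedralGroup_four (φ : GroupIso G (DihedralGroup 4)) :
    HasTableColumn G 4 2 :=
  φ.hasTableColumn isNumbering_dihedralGroup_four [53, 58] (by decide +kernel)
    (by decide +kernel)

theorem hasTableColumn_zmod_four_prod_zmod_two
    (φ : GroupIso G (Multiplicative (ZMod 4 × ZMod 2))) : HasTableColumn G 4 4 :=
  φ.hasTableColumn isNumbering_zmod_four_prod_zmod_two [23, 27, 53, 54] (by decide +kernel)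
    (by decide +kernel)

theorem hasTableColumn_zmod_eight (φ : GroupIso G (Multiplicative (ZMod 8))) :
    HasTableColumn G 4 8 :=
  φ.hasTableColumn isNumbering_zmod_eight [23, 27, 29, 39, 43, 53] (by decide +kernel)
    (by decide +kernel)

theorem hasTableColumn_quaternionGroup_two (φ : GroupIso G (QuaternionGroup 2)) :
    HasTableColumn G 4 8 :=
  φ.hasTableColumn isNumbering_quaternionGroup_two [23, 27, 29, 30, 53, 58] (by decide +kernel)
    (by decide +kernel)

end Columns

/-! ### Groups of order at most eight -/

theorem groupIso_zmod_of_isCyclic {G : Type u} [Group G] (h : IsCyclic G) {n : ℕ}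
    (hn : Nat.card G = n) : GroupIso G (Multiplicative (ZMod n)) := by
  subst hn
  exact ⟨(zmodCyclicMulEquiv h).symm⟩

theorem groupIso_of_injective {G : Type u} [Group G] {H : Type} [Group H] [Finite G]
    (f : H →* G) (hf : Function.Injective f) (hc : Nat.card G = Nat.card H) : GroupIso G H := by
  have := Finite.of_injective f hf
  exact ⟨(MulEquiv.ofBijective f ((Nat.bijective_iff_injective_and_card f).2
    ⟨hf, hc.symm⟩)).symm⟩

/-- Groups in which every element has square one are determined by their cardinality. -/
theorem groupIso_of_sq_eq_one {G : Type u} [Group G] [Finite G] (hG : ∀ x : G, x ^ 2 = 1)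
    {H : Type} [AddCommGroup H] [Module (ZMod 2) H] [Finite H]
    (hc : Nat.card G = Nat.card H) : GroupIso G (Multiplicative H) := by
  have hinv : ∀ z : G, z⁻¹ = z := fun z => inv_eq_of_mul_eq_one_left (by rw [← sq, hG])
  have hcomm : ∀ x y : G, x * y = y * x := fun x y => by
    rw [← hinv (x * y), mul_inv_rev, hinv, hinv]
  let _ : CommGroup G := { ‹Group G› with mul_comm := hcomm }
  let _ : Module (ZMod 2) (Additive G) := AddCommGroup.zmodModule fun x => hG x.toMul
  have h1 := Module.natCard_eq_pow_finrank (K := ZMod 2) (V := Additive G)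
  have h2 := Module.natCard_eq_pow_finrank (K := ZMod 2) (V := H)
  have h3 : Nat.card (Additive G) = Nat.card H := hc
  rw [h1, h2, Nat.card_zmod] at h3
  have h4 := Nat.pow_right_injective le_rfl h3
  exact ⟨AddEquiv.toMultiplicativeRight
    (LinearEquiv.ofFinrankEq (R := ZMod 2) (Additive G) H h4).toAddEquiv⟩

/-! ### Recognising a group from a cyclic subgroup and one outside element. -/

section CyclicHom

variable {G : Type u} [Group G] {a b : G} {n : ℕ}

theorem exists_zmod_hom (ha : orderOf a = n) : ∃ f : Multiplicative (ZMod n) →* G,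
    Function.Injective f ∧ f.range = Subgroup.zpowers a ∧
      ∀ k : ℕ, f (.ofAdd (k : ZMod n)) = a ^ k := by
  have hg : ∀ x : Subgroup.zpowers a, x ∈ Subgroup.zpowers
      (⟨a, Subgroup.mem_zpowers a⟩ : Subgroup.zpowers a) := by
    rintro ⟨x, k, rfl⟩
    exact ⟨k, Subtype.ext (by simp)⟩
  have hn : Nat.card (Subgroup.zpowers a) = n := by rw [Nat.card_zpowers, ha]
  refine ⟨(Subgroup.zpowers a).subtype.comp (zmodMulEquivOfGenerator hg hn).toMonoidHom,
    Subtype.val_injective.comp (zmodMulEquivOfGenerator hg hn).injective, ?_, fun k => ?_⟩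
  · have htop : (zmodMulEquivOfGenerator hg hn).toMonoidHom.range = ⊤ :=
      MonoidHom.range_eq_top.2 (zmodMulEquivOfGenerator hg hn).surjective
    rw [MonoidHom.range_comp, htop, ← MonoidHom.range_eq_map, Subgroup.range_subtype]
  · have := zmodMulEquivOfGenerator_apply_ofAdd_intCast hg hn k
    simp only [Int.cast_natCast] at this
    simp [this]

theorem mul_eq_mul_inv_of_mem_zpowers (hab : b * a * b⁻¹ = a⁻¹) {x : G}
    (hx : x ∈ Subgroup.zpowers a) : x * b = b * x⁻¹ := by
  obtain ⟨k, rfl⟩ := hx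
  have h : b * a ^ k * b⁻¹ = (a ^ k)⁻¹ := by rw [← conj_zpow, hab, inv_zpow]
  have h' : b * (a ^ k)⁻¹ * b⁻¹ = a ^ k := by rw [← conj_inv, h, inv_inv]
  calc a ^ k * b = b * (a ^ k)⁻¹ * b⁻¹ * b := by rw [h']
    _ = b * (a ^ k)⁻¹ := by group

/-- The relations make `sr i ↦ b * a ^ i` a homomorphism; it is injective because `b` lies outside
`⟨a⟩`, and cardinalities agree. -/
theorem groupIso_dihedralGroup [Finite G] [NeZero n] (hG : Nat.card G = 2 * n)
    (ha : orderOf a = n) (hb : b ∉ Subgroup.zpowers a) (hab : b * a * b⁻¹ = a⁻¹)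
    (hb2 : b ^ 2 = 1) : GroupIso G (DihedralGroup n) := by
  obtain ⟨f, hf, hr, -⟩ := exists_zmod_hom ha
  have hmem : ∀ i, f i ∈ Subgroup.zpowers a := fun i => hr ▸ ⟨i, rfl⟩
  have hc : ∀ i, f i * b = b * (f i)⁻¹ := fun i => mul_eq_mul_inv_of_mem_zpowers hab (hmem i)
  let F : DihedralGroup n → G
    | .r i => f (.ofAdd i)
    | .sr i => b * f (.ofAdd i)
  let F' : DihedralGroup n →* G := MonoidHom.mk' F (by
    rintro (i | i) (j | j)
    · simp [F, ofAdd_add]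
    · simp only [F, DihedralGroup.r_mul_sr, sub_eq_neg_add, ofAdd_add, ofAdd_neg, map_mul, map_inv]
      rw [← mul_assoc, ← mul_assoc, hc]
    · simp [F, ofAdd_add, mul_assoc]
    · simp only [F, DihedralGroup.sr_mul_sr, sub_eq_neg_add, ofAdd_add, ofAdd_neg, map_mul,
        map_inv]
      rw [mul_assoc b, ← mul_assoc _ b, hc, ← mul_assoc, ← mul_assoc, ← sq, hb2, one_mul])
  refine groupIso_of_injective F' ((injective_iff_map_eq_one F').2 ?_)
    (by rw [hG, DihedralGroup.nat_card])
  rintro (i | i) hi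
  · have := hf (hi.trans f.map_one.symm)
    rw [DihedralGroup.one_def]
    exact congrArg DihedralGroup.r (Multiplicative.ofAdd.injective this)
  · refine absurd ?_ hb
    rw [eq_inv_of_mul_eq_one_left (a := b) (b := f (.ofAdd i)) hi]
    exact inv_mem (hmem _)

theorem groupIso_quaternionGroup [Finite G] [NeZero n] (hG : Nat.card G = 4 * n)
    (ha : orderOf a = 2 * n) (hb : b ∉ Subgroup.zpowers a) (hab : b * a * b⁻¹ = a⁻¹)
    (hb2 : b ^ 2 = a ^ n) : GroupIso G (QuaternionGroup n) := by
  obtain ⟨f, hf, hr, hfa⟩ := exists_zmod_hom ha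
  have hmem : ∀ i, f i ∈ Subgroup.zpowers a := fun i => hr ▸ ⟨i, rfl⟩
  have hc : ∀ i, f i * b = b * (f i)⁻¹ := fun i => mul_eq_mul_inv_of_mem_zpowers hab (hmem i)
  let F : QuaternionGroup n → G
    | .a i => f (.ofAdd i)
    | .xa i => b * f (.ofAdd i)
  let F' : QuaternionGroup n →* G := MonoidHom.mk' F (by
    rintro (i | i) (j | j)
    · simp [F, ofAdd_add]
    · simp only [F, QuaternionGroup.a_mul_xa, sub_eq_neg_add, ofAdd_add, ofAdd_neg, map_mul,
        map_inv]
      rw [← mul_assoc, ← mul_assoc, hc]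
    · simp [F, ofAdd_add, mul_assoc]
    -- The summand `n` is split off so that its image `a ^ n` can be replaced by `b ^ 2`.
    · simp only [F, QuaternionGroup.xa_mul_xa, add_sub_assoc]
      simp only [sub_eq_neg_add, ofAdd_add, ofAdd_neg, map_mul, map_inv, hfa]
      rw [mul_assoc b, ← mul_assoc _ b, hc, ← hb2, sq]
      simp only [mul_assoc])
  refine groupIso_of_injective F' ((injective_iff_map_eq_one F').2 ?_)
    (by rw [hG, Nat.card_eq_fintype_card, QuaternionGroup.card])
  rintro (i | i) hi
  · have := hf (hi.trans f.map_one.symm)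
    rw [QuaternionGroup.one_def]
    exact congrArg QuaternionGroup.a (Multiplicative.ofAdd.injective this)
  · refine absurd ?_ hb
    rw [eq_inv_of_mul_eq_one_left (a := b) (b := f (.ofAdd i)) hi]
    exact inv_mem (hmem _)

theorem groupIso_zmod_prod_zmod_two [Finite G] [NeZero n] (hG : Nat.card G = 2 * n)
    (ha : orderOf a = n) (hb : b ∉ Subgroup.zpowers a) (hab : Commute a b)
    (hb2 : b ^ 2 = 1) : GroupIso G (Multiplicative (ZMod n × ZMod 2)) := by
  have hb1 : b ≠ 1 := fun h => hb (h ▸ one_mem _)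
  obtain ⟨f, hf, hr, -⟩ := exists_zmod_hom ha
  obtain ⟨g, hg, hs, -⟩ := exists_zmod_hom (orderOf_eq_prime hb2 hb1)
  have hmemf : ∀ i, f i ∈ Subgroup.zpowers a := fun i => hr ▸ ⟨i, rfl⟩
  have hmemg : ∀ i, g i ∈ Subgroup.zpowers b := fun i => hs ▸ ⟨i, rfl⟩
  have hcomm : ∀ i j, Commute (f i) (g j) := by
    intro i j
    obtain ⟨k, hk⟩ := hmemf i
    obtain ⟨l, hl⟩ := hmemg j
    rw [← hk, ← hl]
    exact (hab.zpow_zpow k l)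
  have hdisj : Disjoint f.range g.range := by
    rw [hr, hs, Subgroup.disjoint_def]
    rintro x hx ⟨k, rfl⟩
    -- Every power of `b` is `1` or `b`, and `b` is not in `⟨a⟩`.
    have h2 : ∀ l : ℤ, b ^ (2 * l) = 1 := fun l => by
      rw [zpow_mul, zpow_ofNat, hb2, one_zpow]
    rcases Int.even_or_odd' k with ⟨l, rfl | rfl⟩
    · exact h2 l
    · have h1 : b ^ (2 * l + 1) = b := by rw [zpow_add, h2, one_mul, zpow_one]
      exact absurd (h1 ▸ hx) hb
  have hinj : Function.Injective (f.noncommCoprod g hcomm) :=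
    (MonoidHom.noncommCoprod_injective _ _ _).2 ⟨hf, hg, hdisj⟩
  let e := MulEquiv.prodMultiplicative (ZMod n) (ZMod 2)
  refine groupIso_of_injective ((f.noncommCoprod g hcomm).comp e.toMonoidHom)
    (hinj.comp e.injective) ?_
  simp [hG, mul_comm]

end CyclicHom

/-! ### Classification in orders four, six and eight. -/

section SmallOrder

variable {G : Type u} [Group G]

theorem index_zpowers_eq_two {a : G} {n : ℕ} (hn : 0 < n) (hG : Nat.card G = 2 * n)
    (ha : orderOf a = n) : (Subgroup.zpowers a).index = 2 := by
  have := (Subgroup.zpowers a).card_mul_index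
  rw [Nat.card_zpowers, ha, hG, mul_comm 2] at this
  exact Nat.eq_of_mul_eq_mul_left hn this

variable [Finite G]

theorem exists_pow_eq_of_mem_zpowers {a x : G} {n : ℕ} (ha : orderOf a = n)
    (hx : x ∈ Subgroup.zpowers a) : ∃ k < n, a ^ k = x := by
  classical
  rw [mem_zpowers_iff_mem_range_orderOf, Finset.mem_image] at hx
  obtain ⟨k, hk, rfl⟩ := hx
  exact ⟨k, ha ▸ Finset.mem_range.1 hk, rfl⟩

theorem groupIso_of_card_eq_four (hG : Nat.card G = 4) :
    GroupIso G (Multiplicative (ZMod 4)) ∨ GroupIso G (Multiplicative (ZMod 2 × ZMod 2)) := by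
  by_cases hc : IsCyclic G
  · exact Or.inl (groupIso_zmod_of_isCyclic hc hG)
  · refine Or.inr (groupIso_of_sq_eq_one (fun x => ?_) (by simp [hG]))
    have h1 : orderOf x ∣ 2 ^ 2 := by
      rw [show 2 ^ 2 = Nat.card G by rw [hG]; rfl]
      exact orderOf_dvd_natCard x
    rw [Nat.dvd_prime_pow Nat.prime_two] at h1
    obtain ⟨k, hk, hx⟩ := h1
    have hk2 : k ≠ 2 := by
      rintro rfl
      exact hc (isCyclic_of_orderOf_eq_card x (by rw [hx, hG]; rfl))
    exact orderOf_dvd_iff_pow_eq_one.1 (hx ▸ pow_dvd_pow 2 (show k ≤ 1 by omega))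

theorem groupIso_of_card_eq_six (hG : Nat.card G = 6) :
    GroupIso G (DihedralGroup 3) ∨ GroupIso G (Multiplicative (ZMod 6)) := by
  have : Fact (Nat.Prime 3) := ⟨Nat.prime_three⟩
  obtain ⟨a, ha⟩ := exists_prime_orderOf_dvd_card' (G := G) 3 (by rw [hG]; decide)
  obtain ⟨b, hb⟩ := exists_prime_orderOf_dvd_card' (G := G) 2 (by rw [hG]; decide)
  have hnorm := Subgroup.normal_of_index_eq_two (index_zpowers_eq_two (by decide) hG ha)
  have hba : b ∉ Subgroup.zpowers a := by
    intro h
    have := orderOf_dvd_of_mem_zpowers h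
    rw [ha, hb] at this
    revert this
    decide
  have ha3 : a ^ 3 = 1 := ha ▸ pow_orderOf_eq_one a
  obtain ⟨k, hk, hk'⟩ := exists_pow_eq_of_mem_zpowers ha
    (hnorm.conj_mem a (Subgroup.mem_zpowers a) b)
  interval_cases k
  · rw [pow_zero, eq_comm, conj_eq_one_iff] at hk'
    rw [hk', orderOf_one] at ha
    omega
  · have hab : Commute a b := by
      rw [pow_one, eq_mul_inv_iff_mul_eq] at hk'
      exact hk'
    refine Or.inr (groupIso_zmod_of_isCyclic (isCyclic_of_orderOf_eq_card (a * b) ?_) hG)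
    rw [hab.orderOf_mul_eq_mul_orderOf_of_coprime (by rw [ha, hb]; decide), ha, hb, hG]
  · refine Or.inl (groupIso_dihedralGroup hG ha hba ?_ (hb ▸ pow_orderOf_eq_one b))
    rw [← hk', eq_inv_iff_mul_eq_one, ← pow_succ, ha3]

theorem groupIso_of_card_eq_eight (hG : Nat.card G = 8) :
    GroupIso G (Multiplicative (ZMod 2 × ZMod 2 × ZMod 2)) ∨ GroupIso G (DihedralGroup 4) ∨
      GroupIso G (Multiplicative (ZMod 4 × ZMod 2)) ∨ GroupIso G (Multiplicative (ZMod 8)) ∨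
      GroupIso G (QuaternionGroup 2) := by
  by_cases hc : IsCyclic G
  · exact Or.inr (Or.inr (Or.inr (Or.inl (groupIso_zmod_of_isCyclic hc hG))))
  have h4 : ∀ x : G, x ^ 4 = 1 := by
    intro x
    have h1 : orderOf x ∣ 2 ^ 3 := by
      rw [show 2 ^ 3 = Nat.card G by rw [hG]; rfl]
      exact orderOf_dvd_natCard x
    rw [Nat.dvd_prime_pow Nat.prime_two] at h1
    obtain ⟨k, hk, hx⟩ := h1
    have hk3 : k ≠ 3 := by
      rintro rfl
      exact hc (isCyclic_of_orderOf_eq_card x (by rw [hx, hG]; rfl))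
    exact orderOf_dvd_iff_pow_eq_one.1 (hx ▸ pow_dvd_pow 2 (show k ≤ 2 by omega))
  by_cases h2 : ∀ x : G, x ^ 2 = 1
  · exact Or.inl (groupIso_of_sq_eq_one h2 (by simp [hG]))
  push Not at h2
  obtain ⟨a, ha2⟩ := h2
  have ha : orderOf a = 4 := orderOf_eq_prime_pow (p := 2) (n := 1) (by simpa using ha2) (h4 a)
  have hidx := index_zpowers_eq_two (by decide) hG ha
  have hnorm := Subgroup.normal_of_index_eq_two hidx
  obtain ⟨b, hb⟩ : ∃ b, b ∉ Subgroup.zpowers a := by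
    by_contra! h
    rw [(Subgroup.eq_top_iff' _).2 h, Subgroup.index_top] at hidx
    omega
  have hbsq : b ^ 2 = 1 ∨ b ^ 2 = a ^ 2 := by
    obtain ⟨k, hk, hk'⟩ := exists_pow_eq_of_mem_zpowers ha
      (Subgroup.sq_mem_of_index_two hidx b)
    -- Since `b ^ 4 = 1`, the exponent of `b ^ 2` as a power of `a` is even.
    have hk2 : a ^ (k * 2) = 1 := by rw [pow_mul, hk', ← pow_mul, h4]
    rw [← orderOf_dvd_iff_pow_eq_one, ha] at hk2
    obtain rfl | rfl : k = 0 ∨ k = 2 := by omega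
    · exact Or.inl (by rw [← hk', pow_zero])
    · exact Or.inr hk'.symm
  obtain ⟨k, hk, hk'⟩ := exists_pow_eq_of_mem_zpowers ha
    (hnorm.conj_mem a (Subgroup.mem_zpowers a) b)
  -- A conjugate of `a` has nontrivial square, so `k` is odd.
  have hk2 : a ^ (k * 2) ≠ 1 := by
    rw [pow_mul, hk', conj_pow, Ne, conj_eq_one_iff]
    exact ha2
  rw [Ne, ← orderOf_dvd_iff_pow_eq_one, ha] at hk2
  obtain rfl | rfl : k = 1 ∨ k = 3 := by omega
  · have hab : Commute a b := by
      rw [pow_one, eq_mul_inv_iff_mul_eq] at hk'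
      exact hk'
    refine Or.inr (Or.inr (Or.inl ?_))
    rcases hbsq with hb2 | hb2
    · exact groupIso_zmod_prod_zmod_two hG ha hb hab hb2
    -- As `b` commutes with `a` and `b ^ 2 = a ^ 2`, the element `a⁻¹ * b` is an involution outside
    -- `⟨a⟩`.
    · refine groupIso_zmod_prod_zmod_two (b := a⁻¹ * b) hG ha (fun h => hb ?_)
        ((Commute.refl a).inv_right.mul_right hab) ?_
      · simpa using mul_mem (Subgroup.mem_zpowers a) h
      · rw [hab.inv_left.mul_pow, hb2, inv_pow, inv_mul_cancel]
  · have hinv : b * a * b⁻¹ = a⁻¹ := by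
      rw [← hk', eq_inv_iff_mul_eq_one, ← pow_succ, h4]
    rcases hbsq with hb2 | hb2
    · exact Or.inr (Or.inl (groupIso_dihedralGroup hG ha hb hinv hb2))
    · exact Or.inr (Or.inr (Or.inr (Or.inr (groupIso_quaternionGroup hG ha hb hinv hb2))))

end SmallOrder

theorem mainTheorem9 (G : Type u) [Group G] [Finite G] (hG : Nat.card G ≤ 8) :
    -- every group of order at most 8 occurs in the table
    (GroupIso G (Multiplicative (ZMod 1)) ∨
      GroupIso G (Multiplicative (ZMod 2)) ∨
      GroupIso G (Multiplicative (ZMod 3)) ∨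
      GroupIso G (Multiplicative (ZMod 4)) ∨
      GroupIso G (Multiplicative (ZMod 2 × ZMod 2)) ∨
      GroupIso G (Multiplicative (ZMod 5)) ∨
      GroupIso G (DihedralGroup 3) ∨
      GroupIso G (Multiplicative (ZMod 6)) ∨
      GroupIso G (Multiplicative (ZMod 7)) ∨
      GroupIso G (Multiplicative (ZMod 2 × ZMod 2 × ZMod 2)) ∨
      GroupIso G (DihedralGroup 4) ∨
      GroupIso G (Multiplicative (ZMod 4 × ZMod 2)) ∨
      GroupIso G (Multiplicative (ZMod 8)) ∨
      GroupIso G (QuaternionGroup 2)) ∧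
    -- the columns of the table
    (GroupIso G (Multiplicative (ZMod 1)) → HasTableColumn G 1 1) ∧
    (GroupIso G (Multiplicative (ZMod 2)) → HasTableColumn G 2 1) ∧
    (GroupIso G (Multiplicative (ZMod 3)) → HasTableColumn G 2 1) ∧
    (GroupIso G (Multiplicative (ZMod 4)) → HasTableColumn G 3 1) ∧
    (GroupIso G (Multiplicative (ZMod 2 × ZMod 2)) → HasTableColumn G 3 1) ∧
    (GroupIso G (Multiplicative (ZMod 5)) → HasTableColumn G 3 1) ∧
    (GroupIso G (DihedralGroup 3) → HasTableColumn G 4 1) ∧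
    (GroupIso G (Multiplicative (ZMod 6)) → HasTableColumn G 3 2) ∧
    (GroupIso G (Multiplicative (ZMod 7)) → HasTableColumn G 3 3) ∧
    (GroupIso G (Multiplicative (ZMod 2 × ZMod 2 × ZMod 2)) → HasTableColumn G 5 1) ∧
    (GroupIso G (DihedralGroup 4) → HasTableColumn G 4 2) ∧
    (GroupIso G (Multiplicative (ZMod 4 × ZMod 2)) → HasTableColumn G 4 4) ∧
    (GroupIso G (Multiplicative (ZMod 8)) → HasTableColumn G 4 8) ∧
    (GroupIso G (QuaternionGroup 2) → HasTableColumn G 4 8) := by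
  refine ⟨?_, hasTableColumn_zmod_one, hasTableColumn_zmod_two, hasTableColumn_zmod_three,
    hasTableColumn_zmod_four, hasTableColumn_zmod_two_prod_zmod_two, hasTableColumn_zmod_five,
    hasTableColumn_dihedralGroup_three, hasTableColumn_zmod_six, hasTableColumn_zmod_seven,
    hasTableColumn_zmod_two_prod_zmod_two_prod_zmod_two, hasTableColumn_dihedralGroup_four,
    hasTableColumn_zmod_four_prod_zmod_two, hasTableColumn_zmod_eight,
    hasTableColumn_quaternionGroup_two⟩
  have hprime : ∀ p : ℕ, p.Prime → Nat.card G = p → GroupIso G (Multiplicative (ZMod p)) :=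
    fun p hp h =>
      have : Fact p.Prime := ⟨hp⟩
      groupIso_zmod_of_isCyclic (isCyclic_of_prime_card h) h
  have hpos : 0 < Nat.card G := Nat.card_pos
  generalize hn : Nat.card G = n at hG hpos
  interval_cases n
  · have := (Nat.card_eq_one_iff_unique.1 hn).1
    have := groupIso_zmod_of_isCyclic (isCyclic_of_subsingleton (α := G)) hn
    tauto
  · have := hprime 2 (by norm_num) hn
    tauto
  · have := hprime 3 (by norm_num) hn
    tauto
  · have := groupIso_of_card_eq_four hn
    tauto
  · have := hprime 5 (by norm_num) hn
    tauto
  · have := groupIso_of_card_eq_six hn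
    tauto
  · have := hprime 7 (by norm_num) hn
    tauto
  · have := groupIso_of_card_eq_eight hn
    tauto
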